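/- There are two actions, $\mathcal A=\{1,2\}$, and $T\ge 0$ rounds. Before the game, the adversary fixes loss functions $f_1,\dots,f_T$, $f_t:\mathcal A^t\to\mathbb R$. On round $t$ the player picks $X_t\in\mathcal A$ and observes only the loss $f_t(X_{1:t})$, where $X_{1:t}=(X_1,\dots,X_t)$ (bandit feedback). A player strategy determines $X_t$ as a (measurable) function of the player's internal randomness and of the past actions and observed losses. The expected (policy) regret is $$\mathbb E[R_T]=\mathbb E\Bigl[\sum_{t=1}^T f_t(X_{1:t})\Bigr]-\min_{x\in\mathcal A}\sum_{t=1}^T f_t(x,\dots,x),$$ the expectation being over the player's randomness. The loss functions are oblivious with switching costs if there are $\ell_1,\dots,\ell_T:\mathcal A\to\mathbb R$ such that $f_1(x_1)=\ell_1(x_1)$ and $f_t(x_{1:t})=\ell_t(x_t)+\mathbf 1\{x_t\ne x_{t-1}\}$ for $2\le t\le T$. Theorem. For every (possibly randomized) player strategy that relies on bandit feedback and every number of rounds $T$, there exist (deterministic) loss functions $f_1,\dots,f_T$ that are oblivious with switching costs, with range bounded by $C=2$, i.e. $|f_t(x_{1:t})-f_t(x'_{1:t})|\le 2$ for all $1\le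 t\le T$ and all $x_{1:t},x'_{1:t}\in\mathcal A^t$, and with drift bounded by $D_t=\sqrt{3\log(t)+16}$, i.e. $|f_t(x_{1:t})-f_{t+1}(x_{1:t},x_t)|\le D_t$ for all $1\le t<T$ and all $x_{1:t}\in\mathcal A^t$, such that $$\mathbb E[R_T]\ \ge\ \tfrac1{40}\,T^{2/3}.$$ -/

import Mathlib

/-- A sequence of history-dependent loss functions over the action set `A`. Rounds are indexed
from `0`: `f t` is the loss function of round `t + 1`, and its argument is the sequence of the
player's actions on rounds `1, …, t + 1`. -/
abbrev LossSequence (A : Type*) : Type _ := (t : ℕ) → (Fin (t + 1) → A) → ℝ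

/-- The loss functions obtained from an oblivious sequence `ℓ` by adding a cost of `1` whenever
the current action differs from the previous one; the first round carries no switching cost. -/
def switchingLoss {A : Type*} [DecidableEq A] (ℓ : ℕ → A → ℝ) : LossSequence A
  | 0, x => ℓ 0 (x 0)
  | t + 1, x => ℓ (t + 1) (x (Fin.last (t + 1))) +
      if x (Fin.last (t + 1)) ≠ x (Fin.last t).castSucc then 1 else 0

/-- On its first `T` rounds, `f` is an oblivious adversary with switching costs. -/
def IsObliviousWithSwitchingCosts {A : Type*} [DecidableEq A] (T : ℕ) (f : LossSequence A) :
    Prop :=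
  ∃ ℓ : ℕ → A → ℝ, ∀ t < T, f t = switchingLoss ℓ t

/-- On each of the first `T` rounds, any two loss values differ by at most `C`. -/
def HasRangeBound {A : Type*} (T : ℕ) (f : LossSequence A) (C : ℝ) : Prop :=
  ∀ t < T, ∀ x x' : Fin (t + 1) → A, |f t x - f t x'| ≤ C

/-- For every round `t` among `1, …, T - 1`, repeating the action of round `t` on round `t + 1`
changes the loss by at most `D t`. (With indexing from `0`, the round `t + 1` is given by `f t`,
so its drift bound is `D (t + 1)`.) -/
def HasDriftBound {A : Type*} (T : ℕ) (f : LossSequence A) (D : ℕ → ℝ) : Prop :=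
  ∀ t, t + 1 < T → ∀ x : Fin (t + 1) → A,
    |f t x - f (t + 1) (Fin.snoc x (x (Fin.last t)) : Fin (t + 2) → A)| ≤ D (t + 1)

/-- A (possibly randomized) player strategy with bandit feedback. The sample space `Ω` carries the
player's internal randomness; after `t` rounds the next action is a function of that randomness
and of the actions played and the losses suffered so far. -/
structure BanditPlayer (A Ω : Type*) [MeasurableSpace A] [MeasurableSpace Ω] where
  act : (t : ℕ) → Ω → (Fin t → A × ℝ) → A
  measurable_act : ∀ t, Measurable fun p : Ω × (Fin t → A × ℝ) => act t p.1 p.2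

namespace BanditPlayer

variable {A Ω : Type*} [MeasurableSpace A] [MeasurableSpace Ω]

/-- The actions played and the losses observed on the first `t` rounds against the loss
functions `f`. -/
def history (P : BanditPlayer A Ω) (f : LossSequence A) (ω : Ω) : (t : ℕ) → Fin t → A × ℝ
  | 0 => Fin.elim0
  | t + 1 =>
    let h := P.history f ω t
    let x := P.act t ω h
    (Fin.snoc h (x, f t (Fin.snoc (fun i => (h i).1) x : Fin (t + 1) → A)) :
      Fin (t + 1) → A × ℝ)

/-- The actions played on the first `t` rounds. -/
def actions (P : BanditPlayer A Ω) (f : LossSequence A) (ω : Ω) (t : ℕ) : Fin t → A :=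
  fun i => (P.history f ω t i).1

/-- The (policy) regret after `T` rounds: the player's cumulative loss minus that of the best
fixed action, where a fixed action is played on all rounds. -/
noncomputable def regret [Fintype A] [Nonempty A] (P : BanditPlayer A Ω) (f : LossSequence A)
    (T : ℕ) (ω : Ω) : ℝ :=
  (∑ t ∈ Finset.range T, f t (P.actions f ω (t + 1))) -
    Finset.univ.inf' Finset.univ_nonempty
      (fun x : A => ∑ t ∈ Finset.range T, f t (fun _ => x))

end BanditPlayer

/-!
The losses are `ε` times a random walk with integer steps, plus `ε` for the worse of the two
actions, where the better action `b` is hidden. A player who repeats his last action observes a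
step of the walk, whose distribution does not depend on `b`; only a switch, which costs `1`, shifts
the observed step, by `2` between the two worlds `b = 0` and `b = 1`.

The steps are bounded, so that the range and drift bounds hold surely: their probabilities are the
squares of a normalized tent function of radius `6 * m`. Translating it by at most `2` lowers the
Hellinger affinity by at most `1 / (4 * m ^ 2)` (`amplitude_overlap_ge`). The randomness is finite
and enters through the recursive mean `walkMean`, which commutes with the integral over the player's
randomness, so that a deterministic walk can be selected in the end.

With the player's randomness fixed, the two worlds are compared by backward induction on the number
of remaining rounds (`coupled_cost_ge`). A history common to both has probabilities `a ^ 2` and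
`c ^ 2`; the next action is wrong in one of the worlds, which costs at least
`ε * min (a ^ 2) (c ^ 2)`, and this is bounded below by a multiple of `a * c` minus a multiple of
`a ^ 2 + c ^ 2`. Summed over histories, `a * c` is the affinity, which after the first round drops on
switches only, and the cost `a ^ 2 + c ^ 2 ≥ 2 * (a * c)` of a switch pays for the drop as long as
`ε * T ≤ 6 * m ^ 2`. For `m = ⌈T ^ (1 / 3)⌉` and `ε = 1 / (2 * m)` the mean regrets in the two
worlds add up to at least `ε * T / 3`, so that one of them is at least `ε * T / 6 ≥ T ^ (2 / 3) / 24`.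
-/

/-! ### The distribution of a step -/

/-- The tent function of radius `n` on the integers. -/
noncomputable def tent (n : ℕ) (k : ℤ) : ℝ := max ((n : ℝ) - |(k : ℝ)|) 0

/-- A window that contains the support of `tent n` and of its translates by at most `2`. -/
noncomputable def stepWindow (n : ℕ) : Finset ℤ := Finset.Icc (-((n : ℤ) + 2)) ((n : ℤ) + 2)

/-- The sum of the squares of the tent function. -/
noncomputable def tentMass (n : ℕ) : ℝ := ∑ k ∈ stepWindow n, tent n k ^ 2

/-- The square root of the probability that a step of the random walk equals `k`: the tent
function, normalized in `ℓ²`. -/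
noncomputable def amplitude (n : ℕ) (k : ℤ) : ℝ := tent n k / √(tentMass n)

theorem tent_eq_zero {n : ℕ} {k : ℤ} (hk : (n : ℤ) ≤ |k|) : tent n k = 0 := by
  have : (n : ℝ) ≤ |(k : ℝ)| := by exact_mod_cast hk
  exact max_eq_right (by linarith)

theorem abs_tent_sub_le (n : ℕ) (k d : ℤ) : |tent n k - tent n (k + d)| ≤ |(d : ℝ)| := by
  refine (abs_max_sub_max_le_abs _ _ _).trans ?_
  have h := abs_abs_sub_abs_le ((k : ℝ) + d) k
  rw [add_sub_cancel_left] at h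
  push_cast
  rwa [sub_sub_sub_cancel_left]

/-- The exact value of the sum is `n (2 n² + 1) / 3`. -/
theorem tentMass_ge (n : ℕ) : 2 * (n : ℝ) ^ 3 / 3 ≤ tentMass n := by
  have hsum : ∀ N : ℕ, ∑ j ∈ Finset.range N, (j : ℝ) ^ 2 = (N - 1) * N * (2 * N - 1) / 6 := by
    intro N
    induction N with
    | zero => simp
    | succ N ih => rw [Finset.sum_range_succ, ih]; push_cast; ring
  have h1 : ∑ k ∈ (Finset.range (n + 1)).image (fun j : ℕ => (j : ℤ) - n), tent n k ^ 2 =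
      ∑ j ∈ Finset.range (n + 1), (j : ℝ) ^ 2 := by
    rw [Finset.sum_image (fun a _ b _ h => by simpa using h)]
    refine Finset.sum_congr rfl fun j hj => ?_
    have hj' : (j : ℝ) ≤ n := by exact_mod_cast Nat.lt_succ_iff.mp (Finset.mem_range.mp hj)
    unfold tent
    push_cast
    rw [abs_of_nonpos (by linarith), max_eq_left (by linarith [Nat.cast_nonneg (α := ℝ) j])]
    ring
  have h2 : ∑ k ∈ (Finset.range n).image (fun j : ℕ => (n : ℤ) - j), tent n k ^ 2 =
      ∑ j ∈ Finset.range n, (j : ℝ) ^ 2 := by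
    rw [Finset.sum_image (fun a _ b _ h => by simpa using h)]
    refine Finset.sum_congr rfl fun j hj => ?_
    have hj' : (j : ℝ) ≤ n := by exact_mod_cast (Finset.mem_range.mp hj).le
    unfold tent
    push_cast
    rw [abs_of_nonneg (by linarith), max_eq_left (by linarith [Nat.cast_nonneg (α := ℝ) j])]
    ring
  have hdisj : Disjoint ((Finset.range (n + 1)).image (fun j : ℕ => (j : ℤ) - n))
      ((Finset.range n).image (fun j : ℕ => (n : ℤ) - j)) := by
    rw [Finset.disjoint_left]
    simp only [Finset.mem_image, Finset.mem_range]
    rintro k ⟨i, hi, rfl⟩ ⟨j, hj, h⟩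
    lia
  have hsub : (Finset.range (n + 1)).image (fun j : ℕ => (j : ℤ) - n) ∪
      (Finset.range n).image (fun j : ℕ => (n : ℤ) - j) ⊆ stepWindow n := by
    intro k
    simp only [stepWindow, Finset.mem_union, Finset.mem_image, Finset.mem_range, Finset.mem_Icc]
    rintro (⟨i, hi, rfl⟩ | ⟨i, hi, rfl⟩) <;> constructor <;> lia
  have h := Finset.sum_le_sum_of_subset_of_nonneg (f := fun k => tent n k ^ 2) hsub
    (fun k _ _ => sq_nonneg _)
  rw [Finset.sum_union hdisj, h1, h2, hsum, hsum] at h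
  unfold tentMass
  refine le_trans ?_ h
  push_cast
  nlinarith [Nat.cast_nonneg (α := ℝ) n]

theorem tentMass_pos {n : ℕ} (hn : 0 < n) : 0 < tentMass n :=
  lt_of_lt_of_le (by positivity) (tentMass_ge n)

theorem amplitude_nonneg (n : ℕ) (k : ℤ) : 0 ≤ amplitude n k :=
  div_nonneg (le_max_right _ _) (Real.sqrt_nonneg _)

theorem abs_lt_of_amplitude_ne_zero {n : ℕ} {k : ℤ} (hk : amplitude n k ≠ 0) : |k| < n := by
  by_contra! h
  exact hk (by simp [amplitude, tent_eq_zero h])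

theorem mem_stepWindow_of_amplitude_ne_zero {n : ℕ} {k d : ℤ} (hd : |d| ≤ 2)
    (hk : amplitude n (k + d) ≠ 0) : k ∈ stepWindow n := by
  have h := abs_lt.mp (abs_lt_of_amplitude_ne_zero hk)
  have h' := abs_le.mp hd
  simp only [stepWindow, Finset.mem_Icc]
  constructor <;> linarith

/-- A change of variables in a sum against the step distribution. -/
theorem sum_amplitude_sq_shift (n : ℕ) {d : ℤ} (hd : |d| ≤ 2) (φ : ℤ → ℝ) :
    ∑ k ∈ stepWindow n, amplitude n (k + d) ^ 2 * φ (k + d) =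
      ∑ k ∈ stepWindow n, amplitude n k ^ 2 * φ k := by
  rw [← finsum_eq_sum_of_support_subset, ← finsum_eq_sum_of_support_subset]
  · exact finsum_comp_equiv (Equiv.addRight d) (f := fun k => amplitude n k ^ 2 * φ k)
  · intro k hk
    refine mem_stepWindow_of_amplitude_ne_zero (d := 0) (by simp) fun h => hk ?_
    rw [add_zero] at h
    simp [h]
  · intro k hk
    exact mem_stepWindow_of_amplitude_ne_zero hd fun h => hk (by simp [h])

theorem sum_amplitude_sq {n : ℕ} (hn : 0 < n) : ∑ k ∈ stepWindow n, amplitude n k ^ 2 = 1 := by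
  have h := tentMass_pos hn
  simp only [amplitude, div_pow, Real.sq_sqrt h.le, ← Finset.sum_div]
  exact div_self h.ne'

/-- The Hellinger affinity between the step distribution and its translate by `d` falls short of
`1` by `O(n⁻²)` only: the tent function is `1`-Lipschitz, and its square has mass of order `n³`. -/
theorem amplitude_overlap_ge {m : ℕ} (hm : 0 < m) {d : ℤ} (hd : |d| ≤ 2) :
    1 - 1 / (4 * (m : ℝ) ^ 2) ≤
      ∑ k ∈ stepWindow (6 * m), amplitude (6 * m) k * amplitude (6 * m) (k + d) := by
  set n := 6 * m with hn
  have hn0 : 0 < n := by lia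
  have hM := tentMass_pos hn0
  have hd' : |(d : ℝ)| ≤ 2 := by exact_mod_cast hd
  have h1 := sum_amplitude_sq hn0
  have h2 : ∑ k ∈ stepWindow n, amplitude n (k + d) ^ 2 = 1 := by
    simpa [h1] using sum_amplitude_sq_shift n hd (fun _ => 1)
  have h3 : ∑ k ∈ stepWindow n, (amplitude n k - amplitude n (k + d)) ^ 2 ≤
      (2 * n + 5) * (4 / tentMass n) := by
    refine (Finset.sum_le_card_nsmul _ _ (4 / tentMass n) fun k _ => ?_).trans_eq ?_
    · rw [amplitude, amplitude, ← sub_div, div_pow, Real.sq_sqrt hM.le]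
      gcongr
      have := (abs_tent_sub_le n k d).trans hd'
      rw [← sq_abs]
      nlinarith [abs_nonneg (tent n k - tent n (k + d))]
    · have hc : (stepWindow n).card = 2 * n + 5 := by
        simp only [stepWindow, Int.card_Icc]
        lia
      rw [hc, nsmul_eq_mul]
      push_cast
      ring
  have h4 : ∑ k ∈ stepWindow n, (amplitude n k - amplitude n (k + d)) ^ 2 =
      2 - 2 * ∑ k ∈ stepWindow n, amplitude n k * amplitude n (k + d) := by
    have : (2 : ℝ) = ∑ k ∈ stepWindow n, amplitude n k ^ 2 +
      ∑ k ∈ stepWindow n, amplitude n (k + d) ^ 2 := by rw [h1, h2]; norm_num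
    nth_rewrite 1 [this]
    rw [Finset.mul_sum, ← Finset.sum_add_distrib, ← Finset.sum_sub_distrib]
    exact Finset.sum_congr rfl fun k _ => by ring
  have hm1 : (1 : ℝ) ≤ m := by exact_mod_cast hm
  have h5 : (2 * (n : ℝ) + 5) * (4 / tentMass n) ≤ 2 * (1 / (4 * (m : ℝ) ^ 2)) := by
    have hge := tentMass_ge n
    have hnm : (n : ℝ) = 6 * m := by rw [hn]; push_cast; ring
    rw [hnm] at hge ⊢
    rw [mul_div_assoc', mul_one_div, div_le_div_iff₀ hM (by positivity)]
    have h6 : (m : ℝ) ^ 2 ≤ (m : ℝ) ^ 3 := by nlinarith [sq_nonneg (m : ℝ)]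
    nlinarith
  linarith

/-! ### Means over the steps of a walk -/

/-- The mean of `F` when the steps `t, …, t + r - 1` of the sequence `ξ` are redrawn independently,
each with probabilities `amplitude n k ^ 2`. -/
noncomputable def walkMean (n : ℕ) : ℕ → ℕ → (ℕ → ℤ) → ((ℕ → ℤ) → ℝ) → ℝ
  | 0, _, ξ, F => F ξ
  | r + 1, t, ξ, F =>
    ∑ k ∈ stepWindow n, amplitude n k ^ 2 * walkMean n r (t + 1) (Function.update ξ t k) F

/-- The steps before the redrawn ones keep their values. -/
theorem walkMean_congr (n r t : ℕ) (ξ : ℕ → ℤ) {F G : (ℕ → ℤ) → ℝ}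
    (h : ∀ ξ' : ℕ → ℤ, (∀ i < t, ξ' i = ξ i) → F ξ' = G ξ') :
    walkMean n r t ξ F = walkMean n r t ξ G := by
  induction r generalizing t ξ with
  | zero => exact h ξ fun _ _ => rfl
  | succ r ih =>
    refine Finset.sum_congr rfl fun k _ => ?_
    rw [ih]
    intro ξ' hξ'
    refine h ξ' fun i hi => ?_
    rw [hξ' i (by lia), Function.update_of_ne hi.ne]

theorem walkMean_const_add {n : ℕ} (hn : 0 < n) (r t : ℕ) (ξ : ℕ → ℤ) (c : ℝ)
    (F : (ℕ → ℤ) → ℝ) :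
    walkMean n r t ξ (fun ξ' => c + F ξ') = c + walkMean n r t ξ F := by
  induction r generalizing t ξ with
  | zero => rfl
  | succ r ih =>
    simp only [walkMean, ih, mul_add, Finset.sum_add_distrib, ← Finset.sum_mul,
      sum_amplitude_sq hn, one_mul]

/-- Some outcome of positive probability is at least as large as the mean. -/
theorem exists_le_of_le_walkMean {n : ℕ} (hn : 0 < n) {r t : ℕ} {ξ : ℕ → ℤ} {c : ℝ}
    {F : (ℕ → ℤ) → ℝ} (h : c ≤ walkMean n r t ξ F) :
    ∃ ξ' : ℕ → ℤ, (∀ i, ξ' i = ξ i ∨ amplitude n (ξ' i) ≠ 0) ∧ c ≤ F ξ' := by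
  induction r generalizing t ξ with
  | zero => exact ⟨ξ, fun _ => Or.inl rfl, h⟩
  | succ r ih =>
    obtain ⟨k, hk, hck⟩ : ∃ k, amplitude n k ≠ 0 ∧
        c ≤ walkMean n r (t + 1) (Function.update ξ t k) F := by
      by_contra! hlt
      refine absurd h (not_le.mpr ?_)
      have hsum : ∑ k ∈ stepWindow n, amplitude n k ^ 2 * c = c := by
        rw [← Finset.sum_mul, sum_amplitude_sq hn, one_mul]
      rw [← hsum]
      refine Finset.sum_lt_sum (fun k _ => ?_) ?_
      · by_cases hk : amplitude n k = 0
        · simp [hk]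
        · exact mul_le_mul_of_nonneg_left (hlt k hk).le (sq_nonneg _)
      · obtain ⟨k, hkm, hk⟩ : ∃ k ∈ stepWindow n, amplitude n k ^ 2 ≠ 0 := by
          by_contra! h0
          exact zero_ne_one ((Finset.sum_eq_zero h0).symm.trans (sum_amplitude_sq hn))
        have hk' : amplitude n k ≠ 0 := fun h0 => hk (by simp [h0])
        exact ⟨k, hkm, mul_lt_mul_of_pos_left (hlt k hk') (by positivity)⟩
    obtain ⟨ξ', hξ', hc⟩ := ih hck
    refine ⟨ξ', fun i => ?_, hc⟩
    by_cases hi : i = t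
    · subst hi
      rcases hξ' i with h' | h'
      · rw [Function.update_self] at h'
        exact Or.inr (h' ▸ hk)
      · exact Or.inr h'
    · simpa [Function.update_of_ne hi] using hξ' i

section Integral

variable {Ω : Type*} [MeasurableSpace Ω] {μ : MeasureTheory.Measure Ω}

theorem integrable_walkMean (n r t : ℕ) (ξ : ℕ → ℤ) {F : (ℕ → ℤ) → Ω → ℝ}
    (hF : ∀ ξ', MeasureTheory.Integrable (F ξ') μ) :
    MeasureTheory.Integrable (fun ω => walkMean n r t ξ fun ξ' => F ξ' ω) μ := by
  induction r generalizing t ξ with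
  | zero => exact hF ξ
  | succ r ih => exact MeasureTheory.integrable_finsetSum _ fun k _ => (ih _ _).const_mul _

theorem walkMean_integral (n r t : ℕ) (ξ : ℕ → ℤ) {F : (ℕ → ℤ) → Ω → ℝ}
    (hF : ∀ ξ', MeasureTheory.Integrable (F ξ') μ) :
    walkMean n r t ξ (fun ξ' => ∫ ω, F ξ' ω ∂μ) =
      ∫ ω, walkMean n r t ξ (fun ξ' => F ξ' ω) ∂μ := by
  induction r generalizing t ξ with
  | zero => rfl
  | succ r ih =>
    simp only [walkMean, ih]
    rw [MeasureTheory.integral_finsetSum _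
      fun k _ => (integrable_walkMean n r _ _ hF).const_mul _]
    exact Finset.sum_congr rfl fun k _ => (MeasureTheory.integral_const_mul _ _).symm

end Integral

/-! ### The random walk adversary -/

/-- The averaging over one step in the backward induction. The numbers `a` and `c` are the
amplitudes (square roots of the probabilities) of a common history in two worlds, and the step `k`
of the first world is matched with the step `k + d` of the second. A lower bound that holds for
every `k` survives with its cross term multiplied by the affinity. -/
theorem amplitude_step_le {n : ℕ} (hn : 0 < n) {d : ℤ} (hd : |d| ≤ 2) {a c A B : ℝ}
    (U V : ℤ → ℝ)
    (h : ∀ k, A * ((a * amplitude n k) * (c * amplitude n (k + d))) -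
        B * ((a * amplitude n k) ^ 2 + (c * amplitude n (k + d)) ^ 2) ≤
      (a * amplitude n k) ^ 2 * U k + (c * amplitude n (k + d)) ^ 2 * V (k + d)) :
    A * (a * c) * ∑ k ∈ stepWindow n, amplitude n k * amplitude n (k + d) - B * (a ^ 2 + c ^ 2) ≤
      a ^ 2 * ∑ k ∈ stepWindow n, amplitude n k ^ 2 * U k +
        c ^ 2 * ∑ k ∈ stepWindow n, amplitude n k ^ 2 * V k := by
  have h1 := sum_amplitude_sq hn
  have h2 : ∑ k ∈ stepWindow n, amplitude n (k + d) ^ 2 = 1 := by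
    simpa [h1] using sum_amplitude_sq_shift n hd (fun _ => 1)
  have h3 : B * (a ^ 2 + c ^ 2) =
      ∑ k ∈ stepWindow n, B * ((a * amplitude n k) ^ 2 + (c * amplitude n (k + d)) ^ 2) := by
    simp only [mul_pow, ← Finset.mul_sum, Finset.sum_add_distrib, h1, h2, mul_one]
  rw [h3, ← sum_amplitude_sq_shift n hd V, Finset.mul_sum, Finset.mul_sum, Finset.mul_sum,
    ← Finset.sum_sub_distrib, ← Finset.sum_add_distrib]
  refine Finset.sum_le_sum fun k _ => ?_
  linarith [h k]

/-- The loss of the action `x` in units of the gap, after the first `t` steps of the walk `ξ`, when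
`b` is the better action. -/
def walkPos (b : Fin 2) (ξ : ℕ → ℤ) (t : ℕ) (x : Fin 2) : ℤ :=
  ∑ i ∈ Finset.range t, ξ i + if x = b then 0 else 1

/-- The adversary whose losses follow the walk `ξ` with steps scaled by `ε`; the action `b` is
better than the other one by `ε` on every round. -/
noncomputable def walkAdversary (ε : ℝ) (b : Fin 2) (ξ : ℕ → ℤ) : LossSequence (Fin 2) :=
  switchingLoss fun t x => ε * (walkPos b ξ (t + 1) x : ℝ)

/-- The excess of the losses of `walkAdversary ε b ξ` over those of the constant action `b`. -/
def gapCost (ε : ℝ) (b : Fin 2) : LossSequence (Fin 2) :=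
  switchingLoss fun _ x => if x = b then 0 else ε

theorem walkPos_update (b : Fin 2) (ξ : ℕ → ℤ) (t : ℕ) (k : ℤ) (x : Fin 2) :
    walkPos b (Function.update ξ t k) (t + 1) x = walkPos b ξ t x + k := by
  have h : ∑ i ∈ Finset.range t, Function.update ξ t k i = ∑ i ∈ Finset.range t, ξ i :=
    Finset.sum_congr rfl fun i hi => Function.update_of_ne (Finset.mem_range.mp hi).ne _ _
  rw [walkPos, walkPos, Finset.sum_range_succ, h, Function.update_self]
  ring

theorem walkPos_sub_walkPos (b : Fin 2) (ξ : ℕ → ℤ) (t : ℕ) (x : Fin 2) :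
    walkPos b ξ t x - walkPos b ξ t b = if x = b then 0 else 1 := by
  simp [walkPos]

theorem walkAdversary_congr (ε : ℝ) (b : Fin 2) {ξ ξ' : ℕ → ℤ} {t : ℕ}
    (h : ∀ i ≤ t, ξ i = ξ' i) : walkAdversary ε b ξ t = walkAdversary ε b ξ' t := by
  have hpos : ∀ x, walkPos b ξ (t + 1) x = walkPos b ξ' (t + 1) x := fun x => by
    rw [walkPos, walkPos, Finset.sum_congr rfl fun i hi =>
      h i (Nat.lt_succ_iff.mp (Finset.mem_range.mp hi))]
  funext x
  cases t <;> simp only [walkAdversary, switchingLoss, hpos]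

theorem walkAdversary_sub_const (ε : ℝ) (b : Fin 2) (ξ : ℕ → ℤ) (t : ℕ) (x : Fin (t + 1) → Fin 2) :
    walkAdversary ε b ξ t x - walkAdversary ε b ξ t (fun _ => b) = gapCost ε b t x := by
  have h : ∀ s y, ε * (walkPos b ξ s y : ℝ) - ε * (walkPos b ξ s b : ℝ) =
      if y = b then 0 else ε := fun s y => by
    rw [← mul_sub, ← Int.cast_sub, walkPos_sub_walkPos]
    split_ifs <;> simp
  cases t with
  | zero => simp [walkAdversary, gapCost, switchingLoss, h]
  | succ t =>
    simp only [walkAdversary, gapCost, switchingLoss, ← h (t + 1 + 1)]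
    simp only [ne_eq, not_true_eq_false, if_false]
    ring

/-! ### Play against the random walk and coupling of the two worlds -/

section Player

variable {Ω : Type*} [MeasurableSpace Ω] (P : BanditPlayer (Fin 2) Ω) (ω : Ω)

theorem BanditPlayer.history_congr {f f' : LossSequence (Fin 2)} {t : ℕ}
    (h : ∀ s < t, f s = f' s) : P.history f ω t = P.history f' ω t := by
  induction t with
  | zero => rfl
  | succ t ih => simp only [BanditPlayer.history, ih fun s hs => h s (by lia), h t (by lia)]

theorem BanditPlayer.actions_succ (f : LossSequence (Fin 2)) (t : ℕ) :
    P.actions f ω (t + 1) =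
      (Fin.snoc (P.actions f ω t) (P.act t ω (P.history f ω t)) : Fin (t + 1) → Fin 2) := by
  funext i
  refine Fin.lastCases ?_ (fun j => ?_) i
  · simp [BanditPlayer.actions, BanditPlayer.history]
  · simp [BanditPlayer.actions, BanditPlayer.history]

/-- The excess loss of the player on the round with index `s` against `walkAdversary ε b ξ`. -/
noncomputable def walkCost (ε : ℝ) (b : Fin 2) (ξ : ℕ → ℤ) (s : ℕ) : ℝ :=
  gapCost ε b s (P.actions (walkAdversary ε b ξ) ω (s + 1))

theorem walkCost_congr (ε : ℝ) (b : Fin 2) {ξ ξ' : ℕ → ℤ} {t : ℕ} (h : ∀ i < t, ξ i = ξ' i) :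
    walkCost P ω ε b ξ t = walkCost P ω ε b ξ' t := by
  have hh : P.history (walkAdversary ε b ξ) ω t = P.history (walkAdversary ε b ξ') ω t :=
    P.history_congr ω fun s hs => walkAdversary_congr ε b fun i hi => h i (by lia)
  have ha : P.actions (walkAdversary ε b ξ) ω t = P.actions (walkAdversary ε b ξ') ω t :=
    funext fun i => by rw [BanditPlayer.actions, BanditPlayer.actions, hh]
  rw [walkCost, walkCost, P.actions_succ, P.actions_succ, ha, hh]

theorem walkCost_zero (ε : ℝ) (b : Fin 2) (ξ : ℕ → ℤ) :
    walkCost P ω ε b ξ 0 =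
      if P.act 0 ω (P.history (walkAdversary ε b ξ) ω 0) = b then 0 else ε := by
  rw [walkCost, P.actions_succ]
  simp [gapCost, switchingLoss, Fin.snoc]

theorem walkCost_succ (ε : ℝ) (b : Fin 2) (ξ : ℕ → ℤ) (t : ℕ) :
    walkCost P ω ε b ξ (t + 1) =
      (if P.act (t + 1) ω (P.history (walkAdversary ε b ξ) ω (t + 1)) = b then 0 else ε) +
      if P.act (t + 1) ω (P.history (walkAdversary ε b ξ) ω (t + 1)) ≠
        (P.history (walkAdversary ε b ξ) ω (t + 1) (Fin.last t)).1 then 1 else 0 := by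
  rw [walkCost, P.actions_succ]
  simp only [gapCost, switchingLoss, Fin.snoc_last, Fin.snoc_castSucc, BanditPlayer.actions]

theorem walkMean_walkCost_succ {n : ℕ} (hn : 0 < n) (ε : ℝ) (b : Fin 2) (r t : ℕ) (ξ : ℕ → ℤ) :
    walkMean n (r + 1) t ξ (fun ξ' => ∑ s ∈ Finset.Ico t (t + (r + 1)), walkCost P ω ε b ξ' s) =
      walkCost P ω ε b ξ t + ∑ k ∈ stepWindow n, amplitude n k ^ 2 *
        walkMean n r (t + 1) (Function.update ξ t k)
          (fun ξ' => ∑ s ∈ Finset.Ico (t + 1) (t + 1 + r), walkCost P ω ε b ξ' s) := by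
  rw [walkMean_congr (G := fun ξ' => walkCost P ω ε b ξ t +
    ∑ s ∈ Finset.Ico (t + 1) (t + 1 + r), walkCost P ω ε b ξ' s), walkMean_const_add hn]
  · rfl
  · intro ξ' h
    rw [Finset.sum_eq_sum_Ico_succ_bot (by lia), walkCost_congr P ω ε b h]
    congr 3
    lia

/-- The walks `ξ₀` and `ξ₁` cannot be told apart after `t + 1` rounds: the player has seen the same
history with either action being the better one, so that his last action has the same loss. -/
def Coupled (ε : ℝ) (t : ℕ) (ξ₀ ξ₁ : ℕ → ℤ) : Prop :=
  P.history (walkAdversary ε 0 ξ₀) ω (t + 1) = P.history (walkAdversary ε 1 ξ₁) ω (t + 1) ∧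
    walkPos 0 ξ₀ (t + 1) (P.history (walkAdversary ε 0 ξ₀) ω (t + 1) (Fin.last t)).1 =
      walkPos 1 ξ₁ (t + 1) (P.history (walkAdversary ε 0 ξ₀) ω (t + 1) (Fin.last t)).1

theorem coupled_update (ε : ℝ) {t : ℕ} {ξ₀ ξ₁ : ℕ → ℤ} {x : Fin 2}
    (h : P.history (walkAdversary ε 0 ξ₀) ω t = P.history (walkAdversary ε 1 ξ₁) ω t)
    (hx : P.act t ω (P.history (walkAdversary ε 0 ξ₀) ω t) = x) (k : ℤ) :
    Coupled P ω ε t (Function.update ξ₀ t k)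
      (Function.update ξ₁ t (k + (walkPos 0 ξ₀ t x - walkPos 1 ξ₁ t x))) := by
  have hh : ∀ b ξ j, P.history (walkAdversary ε b (Function.update ξ t j)) ω t =
      P.history (walkAdversary ε b ξ) ω t := fun b ξ j =>
    P.history_congr ω fun s hs => walkAdversary_congr ε b fun i hi =>
      Function.update_of_ne (by lia) _ _
  have hpos : walkPos 0 (Function.update ξ₀ t k) (t + 1) x =
      walkPos 1 (Function.update ξ₁ t (k + (walkPos 0 ξ₀ t x - walkPos 1 ξ₁ t x))) (t + 1) x := by
    rw [walkPos_update, walkPos_update]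
    ring
  refine ⟨?_, ?_⟩
  · simp only [BanditPlayer.history, hh, ← h, hx]
    congr 2
    cases t <;> simp [walkAdversary, switchingLoss, hpos, Fin.snoc]
  · simpa only [BanditPlayer.history, hh, hx, Fin.snoc_last] using hpos

/-! ### Backward induction -/

/-- One step of the backward induction on the number of remaining rounds, before the costs of the
current round and the loss of affinity are compared. -/
theorem coupled_step {n : ℕ} (hn : 0 < n) (ε : ℝ) {r t : ℕ} {A B : ℝ}
    (ih : ∀ (ξ₀ ξ₁ : ℕ → ℤ) (a c : ℝ), 0 ≤ a → 0 ≤ c → Coupled P ω ε t ξ₀ ξ₁ →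
      A * (a * c) - B * (a ^ 2 + c ^ 2) ≤
        a ^ 2 * walkMean n r (t + 1) ξ₀
          (fun ξ => ∑ s ∈ Finset.Ico (t + 1) (t + 1 + r), walkCost P ω ε 0 ξ s) +
        c ^ 2 * walkMean n r (t + 1) ξ₁
          (fun ξ => ∑ s ∈ Finset.Ico (t + 1) (t + 1 + r), walkCost P ω ε 1 ξ s))
    {ξ₀ ξ₁ : ℕ → ℤ} {a c : ℝ} (ha : 0 ≤ a) (hc : 0 ≤ c) {x : Fin 2}
    (h : P.history (walkAdversary ε 0 ξ₀) ω t = P.history (walkAdversary ε 1 ξ₁) ω t)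
    (hx : P.act t ω (P.history (walkAdversary ε 0 ξ₀) ω t) = x)
    {d : ℤ} (hd : walkPos 0 ξ₀ t x - walkPos 1 ξ₁ t x = d) (hd2 : |d| ≤ 2) :
    A * (a * c) * ∑ k ∈ stepWindow n, amplitude n k * amplitude n (k + d) - B * (a ^ 2 + c ^ 2) +
        (a ^ 2 * walkCost P ω ε 0 ξ₀ t + c ^ 2 * walkCost P ω ε 1 ξ₁ t) ≤
      a ^ 2 * walkMean n (r + 1) t ξ₀
          (fun ξ => ∑ s ∈ Finset.Ico t (t + (r + 1)), walkCost P ω ε 0 ξ s) +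
        c ^ 2 * walkMean n (r + 1) t ξ₁
          (fun ξ => ∑ s ∈ Finset.Ico t (t + (r + 1)), walkCost P ω ε 1 ξ s) := by
  rw [walkMean_walkCost_succ P ω hn, walkMean_walkCost_succ P ω hn]
  have := amplitude_step_le hn hd2 (a := a) (c := c) (A := A) (B := B)
    (fun k => walkMean n r (t + 1) (Function.update ξ₀ t k)
      (fun ξ => ∑ s ∈ Finset.Ico (t + 1) (t + 1 + r), walkCost P ω ε 0 ξ s))
    (fun k => walkMean n r (t + 1) (Function.update ξ₁ t k)
      (fun ξ => ∑ s ∈ Finset.Ico (t + 1) (t + 1 + r), walkCost P ω ε 1 ξ s))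
    (fun k => ih _ _ _ _ (mul_nonneg ha (amplitude_nonneg _ _))
      (mul_nonneg hc (amplitude_nonneg _ _)) (hd ▸ coupled_update P ω ε h hx k))
  linarith

/-- The mean excess losses of the remaining rounds in the two worlds, weighted by the probabilities
`a ^ 2` and `c ^ 2` of the common history. On each round the action is wrong in one of the worlds,
which costs at least `ε * min (a ^ 2) (c ^ 2) ≥ ε * (4 / 3 * (a * c) - (a ^ 2 + c ^ 2) / 3)`. The
affinity drops on a switch only, and then the switching cost pays for the drop. -/
theorem coupled_cost_ge {m : ℕ} (hm : 0 < m) {ε : ℝ} (hε : 0 ≤ ε) (r : ℕ)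
    (hr : ε * r ≤ 6 * (m : ℝ) ^ 2) (t : ℕ) (ξ₀ ξ₁ : ℕ → ℤ) (a c : ℝ) (ha : 0 ≤ a) (hc : 0 ≤ c)
    (h : Coupled P ω ε t ξ₀ ξ₁) :
    4 / 3 * ε * r * (a * c) - ε * r / 3 * (a ^ 2 + c ^ 2) ≤
      a ^ 2 * walkMean (6 * m) r (t + 1) ξ₀
          (fun ξ => ∑ s ∈ Finset.Ico (t + 1) (t + 1 + r), walkCost P ω ε 0 ξ s) +
        c ^ 2 * walkMean (6 * m) r (t + 1) ξ₁
          (fun ξ => ∑ s ∈ Finset.Ico (t + 1) (t + 1 + r), walkCost P ω ε 1 ξ s) := by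
  induction r generalizing t ξ₀ ξ₁ a c with
  | zero => simp [walkMean]
  | succ r ih =>
    have hr' : ε * r ≤ 6 * (m : ℝ) ^ 2 := by push_cast at hr; linarith
    obtain ⟨hh, hpos⟩ := h
    set y := (P.history (walkAdversary ε 0 ξ₀) ω (t + 1) (Fin.last t)).1 with hy
    obtain ⟨x, hx⟩ : ∃ x, P.act (t + 1) ω (P.history (walkAdversary ε 0 ξ₀) ω (t + 1)) = x :=
      ⟨_, rfl⟩
    obtain ⟨d, hd⟩ : ∃ d, walkPos 0 ξ₀ (t + 1) x - walkPos 1 ξ₁ (t + 1) x = d := ⟨_, rfl⟩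
    -- Repeating the action keeps the offset of the walks; switching changes it by `2`.
    have hd' : d = 0 ∧ x = y ∨ |d| ≤ 2 ∧ x ≠ y := by
      unfold walkPos at hd hpos
      generalize ∑ i ∈ Finset.range (t + 1), ξ₀ i = W₀ at hd hpos
      generalize ∑ i ∈ Finset.range (t + 1), ξ₁ i = W₁ at hd hpos
      clear_value y
      rw [abs_le]
      fin_cases x <;> fin_cases y <;> simp at hd hpos ⊢ <;> lia
    have hd2 : |d| ≤ 2 := by
      rcases hd' with ⟨rfl, -⟩ | h'
      · simp
      · exact h'.1
    refine le_trans ?_ (coupled_step P ω (by lia) ε (ih hr' (t + 1)) ha hc hh hx hd hd2)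
    rw [walkCost_succ, walkCost_succ, ← hh, hx, ← hy]
    -- The switching cost, at least `2 * (a * c)`, pays for the drop of the affinity on a switch.
    have hswitch : 4 / 3 * ε * r * (a * c) ≤
        4 / 3 * ε * r * (a * c) *
          (∑ k ∈ stepWindow (6 * m), amplitude (6 * m) k * amplitude (6 * m) (k + d)) +
        (a ^ 2 + c ^ 2) * (if x ≠ y then 1 else 0) := by
      rcases hd' with ⟨rfl, hxy⟩ | ⟨-, hxy⟩
      · have h1 := sum_amplitude_sq (n := 6 * m) (by lia)
        simp only [sq] at h1
        simp [hxy, h1]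
      · rw [if_pos hxy]
        have h1 := amplitude_overlap_ge hm hd2
        have h2 : 0 ≤ 4 / 3 * ε * r * (a * c) := by positivity
        have h3 := mul_le_mul_of_nonneg_left h1 h2
        have h4 : 4 / 3 * ε * r * (a * c) * (1 / (4 * (m : ℝ) ^ 2)) ≤ 2 * (a * c) := by
          have h5 : 4 / 3 * ε * r * (1 / (4 * (m : ℝ) ^ 2)) ≤ 2 := by
            rw [mul_one_div, div_le_iff₀ (by positivity)]
            linarith
          nlinarith [mul_nonneg ha hc]
        linarith [sq_nonneg (a - c)]
    -- `x` is the wrong action in one of the worlds; in either case the inequality is a square.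
    have hgap : ε * (4 / 3 * (a * c) - (a ^ 2 + c ^ 2) / 3) ≤
        a ^ 2 * (if x = 0 then 0 else ε) + c ^ 2 * (if x = 1 then 0 else ε) := by
      clear_value y
      fin_cases x
      · simp only [Fin.zero_eta, if_true, Fin.zero_ne_one, if_false]
        nlinarith [mul_nonneg hε (sq_nonneg (a - 2 * c))]
      · simp only [Fin.mk_one, if_true, Fin.one_eq_zero_iff]
        norm_num
        nlinarith [mul_nonneg hε (sq_nonneg (2 * a - c))]
    push_cast
    linarith

/-- The first round costs `ε` in one of the two worlds, and reveals no more than a switch does. -/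
theorem walkMean_cost_add_ge {m : ℕ} (hm : 0 < m) {ε : ℝ} (hε : 0 ≤ ε) {T : ℕ} (hT : 0 < T)
    (hr : ε * T ≤ 6 * (m : ℝ) ^ 2) :
    ε * T / 3 ≤
      walkMean (6 * m) T 0 0 (fun ξ => ∑ s ∈ Finset.range T, walkCost P ω ε 0 ξ s) +
        walkMean (6 * m) T 0 0 (fun ξ => ∑ s ∈ Finset.range T, walkCost P ω ε 1 ξ s) := by
  obtain ⟨r, rfl⟩ := Nat.exists_eq_succ_of_ne_zero hT.ne'
  have hr' : ε * r ≤ 6 * (m : ℝ) ^ 2 := by push_cast at hr; linarith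
  obtain ⟨x, hx⟩ : ∃ x, P.act 0 ω (P.history (walkAdversary ε 0 0) ω 0) = x := ⟨_, rfl⟩
  -- Without a previous action to cancel against, the two walks differ by `1` here.
  obtain ⟨d, hd⟩ : ∃ d, walkPos 0 0 0 x - walkPos 1 0 0 x = d := ⟨_, rfl⟩
  have hd2 : |d| ≤ 2 := by
    rw [← hd]
    unfold walkPos
    fin_cases x <;> simp
  have hx' : P.act 0 ω (P.history (walkAdversary ε 1 0) ω 0) = x := hx
  have h := coupled_step P ω (by lia) ε (coupled_cost_ge P ω hm hε r hr' 0) (a := 1) (c := 1)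
    zero_le_one zero_le_one rfl hx hd hd2
  rw [walkCost_zero, walkCost_zero, hx, hx'] at h
  have hgap : (if x = 0 then 0 else ε) + (if x = 1 then 0 else ε) = ε := by
    fin_cases x <;> simp
  have hO := amplitude_overlap_ge hm hd2
  have hm1 : (1 : ℝ) ≤ m := by exact_mod_cast hm
  have hη : 1 / (4 * (m : ℝ) ^ 2) ≤ 1 / 4 :=
    one_div_le_one_div_of_le (by norm_num) (by nlinarith)
  have hO' : 3 / 4 ≤
      ∑ k ∈ stepWindow (6 * m), amplitude (6 * m) k * amplitude (6 * m) (k + d) := by linarith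
  have h1 := mul_le_mul_of_nonneg_left hO' (show 0 ≤ 4 / 3 * ε * r by positivity)
  simp only [zero_add, one_pow, one_mul, mul_one, Nat.Ico_zero_eq_range] at h
  simp only [Nat.succ_eq_add_one]
  push_cast
  linarith

/-! ### Measurability and regret -/

theorem BanditPlayer.measurable_history (f : LossSequence (Fin 2)) (t : ℕ) :
    Measurable fun ω => P.history f ω t := by
  induction t with
  | zero => exact measurable_const
  | succ t ih =>
    have hx : Measurable fun ω => P.act t ω (P.history f ω t) :=
      (P.measurable_act t).comp (measurable_id.prodMk ih)
    have hs : Measurable fun ω => (Fin.snoc (fun i => (P.history f ω t i).1)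
        (P.act t ω (P.history f ω t)) : Fin (t + 1) → Fin 2) := by
      refine measurable_pi_iff.mpr fun i => Fin.lastCases ?_ (fun j => ?_) i
      · simpa using hx
      · simpa using (measurable_pi_iff.mp ih j).fst
    refine measurable_pi_iff.mpr fun i => Fin.lastCases ?_ (fun j => ?_) i
    · simpa [BanditPlayer.history] using hx.prodMk ((Measurable.of_discrete (f := f t)).comp hs)
    · simpa [BanditPlayer.history] using measurable_pi_iff.mp ih j

theorem BanditPlayer.integrable_actions (μ : MeasureTheory.Measure Ω)
    [MeasureTheory.IsProbabilityMeasure μ] (f : LossSequence (Fin 2)) (t : ℕ)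
    (φ : (Fin t → Fin 2) → ℝ) :
    MeasureTheory.Integrable (fun ω => φ (P.actions f ω t)) μ := by
  have hm : Measurable fun ω => P.actions f ω t :=
    measurable_pi_iff.mpr fun i =>
      measurable_fst.comp ((measurable_pi_apply i).comp (P.measurable_history f t))
  exact (MeasureTheory.Integrable.of_finite (μ := μ.map _) (f := φ)).comp_measurable hm

theorem sum_walkCost_le_regret (ε : ℝ) (b : Fin 2) (ξ : ℕ → ℤ) (T : ℕ) :
    ∑ s ∈ Finset.range T, walkCost P ω ε b ξ s ≤ P.regret (walkAdversary ε b ξ) T ω := by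
  simp only [walkCost, ← walkAdversary_sub_const ε b ξ, Finset.sum_sub_distrib]
  exact sub_le_sub_left (Finset.inf'_le
    (fun x : Fin 2 => ∑ t ∈ Finset.range T, walkAdversary ε b ξ t fun _ => x)
    (Finset.mem_univ b)) _

end Player

/-! ### Range and drift of the losses -/

theorem walkAdversary_hasRangeBound {ε : ℝ} (hε : 0 ≤ ε) (hε1 : ε ≤ 1) (b : Fin 2) (ξ : ℕ → ℤ)
    (T : ℕ) : HasRangeBound T (walkAdversary ε b ξ) 2 := by
  have h : ∀ t (x : Fin (t + 1) → Fin 2), 0 ≤ gapCost ε b t x ∧ gapCost ε b t x ≤ 2 := by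
    intro t x
    cases t <;> simp only [gapCost, switchingLoss] <;> split_ifs <;> constructor <;> linarith
  intro t _ x x'
  have h1 := walkAdversary_sub_const ε b ξ t x
  have h2 := walkAdversary_sub_const ε b ξ t x'
  rw [abs_le]
  constructor <;> linarith [h t x, h t x']

theorem walkAdversary_hasDriftBound {ε : ℝ} (b : Fin 2) {ξ : ℕ → ℤ}
    (hξ : ∀ i, |ε * ξ i| ≤ 3) (T : ℕ) :
    HasDriftBound T (walkAdversary ε b ξ)
      (fun t => Real.sqrt (3 * Real.log (t : ℝ) + 16)) := by
  intro t _ x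
  have h4 : 4 ≤ Real.sqrt (3 * Real.log ((t + 1 : ℕ) : ℝ) + 16) := by
    refine Real.le_sqrt_of_sq_le ?_
    linarith [Real.log_natCast_nonneg (t + 1)]
  refine le_trans ?_ h4
  have h := abs_le.mp (hξ (t + 1))
  have hstep : ∀ y, ε * (walkPos b ξ (t + 1 + 1) y : ℝ) =
      ε * (walkPos b ξ (t + 1) y : ℝ) + ε * ξ (t + 1) := fun y => by
    rw [walkPos, walkPos, Finset.sum_range_succ]
    push_cast
    ring
  rw [abs_le]
  cases t with
  | zero =>
    simp only [walkAdversary, switchingLoss, hstep]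
    simp [Fin.snoc] at h ⊢
    constructor <;> linarith
  | succ t =>
    simp only [walkAdversary, switchingLoss, hstep, Fin.snoc_last, Fin.snoc_castSucc]
    simp only [ne_eq, not_true_eq_false, if_false]
    split_ifs <;> constructor <;> linarith

/-! ### The regret lower bound -/

theorem theorem1 {Ω : Type*} [MeasurableSpace Ω] (μ : MeasureTheory.Measure Ω)
    [MeasureTheory.IsProbabilityMeasure μ] (P : BanditPlayer (Fin 2) Ω) (T : ℕ) :
    ∃ f : LossSequence (Fin 2),
      IsObliviousWithSwitchingCosts T f ∧
      HasRangeBound T f 2 ∧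
      HasDriftBound T f (fun t => Real.sqrt (3 * Real.log (t : ℝ) + 16)) ∧
      (1 / 40 : ℝ) * (T : ℝ) ^ (2 / 3 : ℝ) ≤ ∫ ω, P.regret f T ω ∂μ := by
  rcases Nat.eq_zero_or_pos T with rfl | hT
  · refine ⟨walkAdversary 0 0 0, ⟨_, fun t _ => rfl⟩,
      walkAdversary_hasRangeBound le_rfl zero_le_one _ _ _,
      walkAdversary_hasDriftBound _ (by simp) _, ?_⟩
    simp [BanditPlayer.regret]
  set y : ℝ := (T : ℝ) ^ (1 / 3 : ℝ) with hy
  have hT1 : (1 : ℝ) ≤ T := by exact_mod_cast hT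
  have hy1 : 1 ≤ y := Real.one_le_rpow hT1 (by norm_num)
  have hy3 : y ^ 3 = T := by
    rw [hy, ← Real.rpow_mul_natCast (by positivity)]
    norm_num
  have hy2 : (T : ℝ) ^ (2 / 3 : ℝ) = y ^ 2 := by
    rw [hy, ← Real.rpow_mul_natCast (by positivity)]
    norm_num
  -- With gap `1 / (2 * m)` and fewer than `6 * m` gaps to a step, the losses drift by at most `3`, and
  -- one more for the switching cost; the affinity bound is then good for `m ^ 3 ≥ T` rounds.
  set m := ⌈y⌉₊ with hm_def
  have hym : y ≤ m := Nat.le_ceil y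
  have hmy : (m : ℝ) ≤ 2 * y := by linarith [Nat.ceil_lt_add_one (show 0 ≤ y by linarith)]
  have hm : 0 < m := Nat.ceil_pos.mpr (by linarith)
  have hm1 : (1 : ℝ) ≤ m := by exact_mod_cast hm
  set ε : ℝ := 1 / (2 * m) with hε_def
  have hε : 0 ≤ ε := by positivity
  have hεm : ε * m = 1 / 2 := by rw [hε_def]; field_simp
  have hTm : (T : ℝ) ≤ (m : ℝ) ^ 3 := by rw [← hy3]; gcongr
  have hr : ε * T ≤ 6 * (m : ℝ) ^ 2 := by
    calc ε * T ≤ ε * (m : ℝ) ^ 3 := by gcongr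
      _ = 1 / 2 * (m : ℝ) ^ 2 := by rw [← hεm]; ring
      _ ≤ _ := by nlinarith [sq_nonneg (m : ℝ)]
  have hcost : ∀ b ξ, MeasureTheory.Integrable
      (fun ω => ∑ s ∈ Finset.range T, walkCost P ω ε b ξ s) μ := fun b ξ =>
    MeasureTheory.integrable_finsetSum _ fun s _ => P.integrable_actions μ _ _ (gapCost ε b s)
  have hmean : ε * T / 3 ≤
      walkMean (6 * m) T 0 0 (fun ξ => ∫ ω, ∑ s ∈ Finset.range T, walkCost P ω ε 0 ξ s ∂μ) +
      walkMean (6 * m) T 0 0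
        (fun ξ => ∫ ω, ∑ s ∈ Finset.range T, walkCost P ω ε 1 ξ s ∂μ) := by
    rw [walkMean_integral _ _ _ _ (hcost 0), walkMean_integral _ _ _ _ (hcost 1),
      ← MeasureTheory.integral_add (integrable_walkMean _ _ _ _ (hcost 0))
        (integrable_walkMean _ _ _ _ (hcost 1))]
    calc ε * T / 3 = ∫ _, ε * T / 3 ∂μ := by simp
      _ ≤ _ := MeasureTheory.integral_mono (MeasureTheory.integrable_const _)
        ((integrable_walkMean _ _ _ _ (hcost 0)).add (integrable_walkMean _ _ _ _ (hcost 1)))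
        fun ω => walkMean_cost_add_ge P ω hm hε hT hr
  obtain ⟨b, hb⟩ : ∃ b, ε * T / 6 ≤ walkMean (6 * m) T 0 0
      (fun ξ => ∫ ω, ∑ s ∈ Finset.range T, walkCost P ω ε b ξ s ∂μ) := by
    by_contra! hlt
    linarith [hlt 0, hlt 1]
  obtain ⟨ξ, hξ, hξb⟩ := exists_le_of_le_walkMean (by lia) hb
  refine ⟨walkAdversary ε b ξ, ⟨_, fun t _ => rfl⟩,
    walkAdversary_hasRangeBound hε (by nlinarith) _ _ _,
    walkAdversary_hasDriftBound _ (fun i => ?_) _, ?_⟩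
  · rcases hξ i with h | h
    · simp [h]
    · have h1 : |(ξ i : ℝ)| ≤ 6 * m := by exact_mod_cast (abs_lt_of_amplitude_ne_zero h).le
      rw [abs_mul, abs_of_nonneg hε]
      nlinarith
  · have hreg : MeasureTheory.Integrable (P.regret (walkAdversary ε b ξ) T) μ :=
      (MeasureTheory.integrable_finsetSum _ fun s _ => P.integrable_actions μ _ _ _).sub
        (MeasureTheory.integrable_const _)
    refine le_trans ?_ (hξb.trans (MeasureTheory.integral_mono (hcost b ξ) hreg
      fun ω => sum_walkCost_le_regret P ω ε b ξ T))
    have h2 : 1 / 4 ≤ ε * y := by nlinarith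
    calc 1 / 40 * (T : ℝ) ^ (2 / 3 : ℝ) ≤ y ^ 2 * (1 / 4) / 6 := by
          rw [hy2]
          linarith [sq_nonneg y]
      _ ≤ y ^ 2 * (ε * y) / 6 := by gcongr
      _ = ε * T / 6 := by rw [← hy3]; ring
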